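/- Let $1\le k\le n$ be integers and let $\mathbb H^n=\mathbb R^n\times\mathbb R^n\times\mathbb R$ be the Heisenberg group with operation $$(x,y,t)(x',y',t')=\Big(x+x',\,y+y',\,t+t'+\tfrac12\sum_{j=1}^n(x_jy_j'-x_j'y_j)\Big)$$ and dilations $\delta_\lambda(x,y,t)=(\lambda x,\lambda y,\lambda^2t)$, $\lambda>0$. Let $\rho$ be a homogeneous distance on $\mathbb H^n$, i.e. a distance with $\rho(gp,gq)=\rho(p,q)$ and $\rho(\delta_\lambda p,\delta_\lambda q)=\lambda\rho(p,q)$ for all $g,p,q\in\mathbb H^n$ and $\lambda>0$, and assume that $\rho$ is rotationally invariant: $\rho(0,(x,y,t))=\rho(0,(x',y',t))$ whenever $|(x,y)|=|(x',y')|$, where $|\cdot|$ is the Euclidean norm of $\mathbb R^{2n}$. For $E\subset\mathbb H^n$ and $d\ge 0$ let $$\mathcal S^d(E)=\lim_{\varepsilon\to0^+}\inf\Big\{\sum_{j\in\mathbb N}(2r_j)^d:\ E\subset\bigcup_{j\in\mathbb N}\overline B_\rho(p_j,r_j),\ p_j\in\mathbb H^n,\ 2r_j<\varepsilon\Big\}$$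 be the spherical Hausdorff measure of $\rho$, where $\overline B_\rho(p,r)$ is the closed ball, and let $\mathcal H^d_E$ be the Euclidean Hausdorff measure on $\mathbb R^{2n+1}\equiv\mathbb H^n$. Both are regarded as outer measures, and $\mu\llcorner P$ denotes the outer measure $A\mapsto\mu(A\cap P)$. Then there is a constant $c=c(n,k)\in(0,\infty)$ (depending on $n$, $k$ and $\rho$ only) such that $$c\,\mathcal S^{2n+2-k}\llcorner\mathbb P=\mathcal H_E^{2n+1-k}\llcorner\mathbb P$$ for every vertical subgroup $\mathbb P$ of $\mathbb H^n$ of codimension $k$, that is, for every subgroup $\mathbb P$ that satisfies $\delta_\lambda(\mathbb P)=\mathbb P$ for all $\lambda>0$, contains $\{(0,0,t):t\in\mathbb R\}$ and has topological dimension $2n+1-k$. The same equality, with the same $c$, holds for every $\mathbb P\in\mathscr T_{\mathbb H^n,\mathbb R^k}$, the set of normal subgroups of $\mathbb H^n$ that are invariant under all dilations, are the kernel of a surjective homomorphism $L:\mathbb H^n\to\mathbb R^k$ with $L\circ\delta_\lambda=\lambda L$ for all $\lambda>0$, and admit a dilation-invariant subgroup $\mathbb V$ with $\mathbb V\cap\mathbb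 P=\{0\}$ and $\mathbb P\mathbb V=\mathbb H^n$ (this is the same class of subgroups). -/

import Mathlib

open MeasureTheory
open scoped ENNReal NNReal

/-- The Heisenberg group `ℍⁿ` in exponential coordinates `(z, t)`, with `z = (x, y) ∈ ℝⁿ × ℝⁿ`:
`x_j = z (Sum.inl j)` and `y_j = z (Sum.inr j)`. -/
@[ext]
structure Heis (n : ℕ) where
  z : EuclideanSpace ℝ (Fin n ⊕ Fin n)
  t : ℝ

namespace Heis

variable {n : ℕ}

/-- `∑ⱼ (xⱼ y'ⱼ - x'ⱼ yⱼ)`. -/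
def symp (z z' : EuclideanSpace ℝ (Fin n ⊕ Fin n)) : ℝ :=
  ∑ j : Fin n, (z (Sum.inl j) * z' (Sum.inr j) - z' (Sum.inl j) * z (Sum.inr j))

noncomputable instance : Mul (Heis n) := ⟨fun p q => ⟨p.z + q.z, p.t + q.t + (1 / 2) * symp p.z q.z⟩⟩

instance : One (Heis n) := ⟨⟨0, 0⟩⟩

instance : Inv (Heis n) := ⟨fun p => ⟨-p.z, -p.t⟩⟩

@[simp] theorem mul_z (p q : Heis n) : (p * q).z = p.z + q.z := rfl

@[simp] theorem mul_t (p q : Heis n) :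
    (p * q).t = p.t + q.t + (1 / 2) * symp p.z q.z := rfl

@[simp] theorem one_z : (1 : Heis n).z = 0 := rfl

@[simp] theorem one_t : (1 : Heis n).t = 0 := rfl

@[simp] theorem inv_z (p : Heis n) : (p⁻¹).z = -p.z := rfl

@[simp] theorem inv_t (p : Heis n) : (p⁻¹).t = -p.t := rfl

theorem symp_add_left (a b c : EuclideanSpace ℝ (Fin n ⊕ Fin n)) :
    symp (a + b) c = symp a c + symp b c := by
  simp only [symp, ← Finset.sum_add_distrib, PiLp.add_apply]
  exact Finset.sum_congr rfl fun j _ => by ring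

theorem symp_add_right (a b c : EuclideanSpace ℝ (Fin n ⊕ Fin n)) :
    symp a (b + c) = symp a b + symp a c := by
  simp only [symp, ← Finset.sum_add_distrib, PiLp.add_apply]
  exact Finset.sum_congr rfl fun j _ => by ring

theorem symp_neg_self (a : EuclideanSpace ℝ (Fin n ⊕ Fin n)) : symp (-a) a = 0 := by
  simp only [symp, PiLp.neg_apply]
  exact Finset.sum_eq_zero fun j _ => by ring

noncomputable instance : Group (Heis n) :=
  Group.ofLeftAxioms
    (fun a b c => by
      ext1
      · simp [add_assoc]
      · simp only [mul_t, mul_z, symp_add_left, symp_add_right]; ring)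
    (fun a => by
      ext1
      · simp
      · simp [symp])
    (fun a => by
      ext1
      · simp
      · simp [symp_neg_self])

/-- The dilation `δ_λ (z, t) = (λ z, λ² t)`. -/
def dil (l : ℝ) (p : Heis n) : Heis n := ⟨l • p.z, l ^ 2 * p.t⟩

/-- The identification `ℍⁿ ≡ ℝ²ⁿ⁺¹`; the target carries its Euclidean norm and distance. -/
def toEuclidean (p : Heis n) : WithLp 2 (EuclideanSpace ℝ (Fin n ⊕ Fin n) × ℝ) :=
  WithLp.toLp 2 (p.z, p.t)

/-- A homogeneous distance: a distance function that is left-invariant and one-homogeneous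
with respect to dilations. -/
structure IsHomogeneousDistance (ρ : Heis n → Heis n → ℝ) : Prop where
  nonneg : ∀ p q, 0 ≤ ρ p q
  eq_zero_iff : ∀ p q, ρ p q = 0 ↔ p = q
  symm : ∀ p q, ρ p q = ρ q p
  triangle : ∀ p q r, ρ p r ≤ ρ p q + ρ q r
  left_invariant : ∀ g p q, ρ (g * p) (g * q) = ρ p q
  homogeneous : ∀ l : ℝ, 0 < l → ∀ p q, ρ (dil l p) (dil l q) = l * ρ p q

/-- `ρ(0, (z, t))` depends on `z = (x, y)` only through its Euclidean norm. -/
def IsRotationallyInvariant (ρ : Heis n → Heis n → ℝ) : Prop :=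
  ∀ (z z' : EuclideanSpace ℝ (Fin n ⊕ Fin n)) (t : ℝ), ‖z‖ = ‖z'‖ → ρ 1 ⟨z, t⟩ = ρ 1 ⟨z', t⟩

/-- Closed ball for the distance `ρ`. -/
def cBall (ρ : Heis n → Heis n → ℝ) (p : Heis n) (r : ℝ) : Set (Heis n) := {q | ρ p q ≤ r}

/-- The spherical Hausdorff (outer) measure of dimension `d` of the distance `ρ`, without
normalization constants. The centers of the covering balls are arbitrary points of `ℍⁿ`. The limit
as `ε → 0⁺` is written as a supremum, the infimum being monotone in `ε`. -/
noncomputable def sphericalMeasure (ρ : Heis n → Heis n → ℝ) (d : ℝ) (E : Set (Heis n)) : ℝ≥0∞ :=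
  ⨆ (ε : ℝ) (_ : 0 < ε),
    ⨅ (x : ℕ → Heis n) (r : ℕ → ℝ) (_ : ∀ j, 0 ≤ r j ∧ 2 * r j < ε)
      (_ : E ⊆ ⋃ j, cBall ρ (x j) (r j)),
      ∑' j, ENNReal.ofReal (2 * r j) ^ d

/-- The Euclidean Hausdorff (outer) measure of integer dimension `d` on `ℍⁿ ≡ ℝ²ⁿ⁺¹`, with the usual
normalization (it is Lebesgue measure on `d`-dimensional planes). -/
noncomputable def euclideanMeasure (d : ℕ) (E : Set (Heis n)) : ℝ≥0∞ :=
  μHE[d] (toEuclidean '' E)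

/-- A subgroup is homogeneous if `δ_λ(P) = P` for every `λ > 0`. -/
def IsHomogeneousSubgroup (P : Subgroup (Heis n)) : Prop :=
  ∀ l : ℝ, 0 < l → dil l '' (P : Set (Heis n)) = P

/-- A homogeneous subgroup is vertical if it contains the second layer `V₂ = {(0, t)}`. -/
def IsVertical (P : Subgroup (Heis n)) : Prop :=
  IsHomogeneousSubgroup P ∧ ∀ t : ℝ, (⟨0, t⟩ : Heis n) ∈ P

/-- A vertical subgroup is a linear subspace of `ℝ²ⁿ⁺¹`, and its topological dimension is its linear
dimension (the dimension of its linear span). -/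
noncomputable def topDim (P : Subgroup (Heis n)) : ℕ :=
  Module.finrank ℝ (Submodule.span ℝ (toEuclidean '' (P : Set (Heis n))))

/-- Homogeneous morphisms `ℍⁿ → ℝᵏ`: group morphisms that commute with the dilations. -/
structure IsHomogeneousMorphism {k : ℕ} (L : Heis n → EuclideanSpace ℝ (Fin k)) : Prop where
  map_mul : ∀ p q, L (p * q) = L p + L q
  map_dil : ∀ l : ℝ, 0 < l → ∀ p, L (dil l p) = l • L p

/-- Two homogeneous subgroups `W`, `V` are complementary if `V ∩ W = {0}` and `ℍⁿ = W V`. -/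
def IsComplementary (W V : Subgroup (Heis n)) : Prop :=
  IsHomogeneousSubgroup W ∧ IsHomogeneousSubgroup V ∧ V ⊓ W = ⊥ ∧
    ∀ g : Heis n, ∃ w ∈ W, ∃ v ∈ V, w * v = g

/-- The tangent subgroups `𝒯_{ℍⁿ, ℝᵏ}`: the normal subgroups that admit a complementary subgroup and
are the kernel of a surjective homogeneous morphism `ℍⁿ → ℝᵏ`. -/
def tangentSubgroups (n k : ℕ) : Set (Subgroup (Heis n)) :=
  {P | P.Normal ∧ (∃ V : Subgroup (Heis n), IsComplementary P V) ∧
    ∃ L : Heis n → EuclideanSpace ℝ (Fin k), IsHomogeneousMorphism L ∧ Function.Surjective L ∧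
      ∀ p, p ∈ P ↔ L p = 0}

end Heis

/-!
A vertical subgroup of codimension `k` is `W × ℝ` for a linear subspace `W` of `ℝ²ⁿ` of dimension
`m = 2n - k`, and `μ = ℋ_E^{m+1}` is Lebesgue measure on it. Left translation turns the part of a
ball `B(p, r)` in `W × ℝ` into a slice of `B(0, r)`, up to a shear, which preserves volume.
Dilations scale volumes by `r ^ (m + 2)`, so `μ(B(p, r)) = r ^ (m + 2) σ`, where `σ` is the volume
of a slice of the unit ball. The supremum `β` of the volumes of these slices is positive, finite,
and the same for all subspaces of dimension `m`: an isometry of `ℝ²ⁿ` that maps one subspace to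
another preserves the distance to the identity, by rotational invariance.

Hence `μ(B(p, r)) ≤ β r ^ (m + 2)` for all balls, and for `η < β` there is, near every point of the
subgroup and at every scale, a ball with `μ(B(p, r)) ≥ η r ^ (m + 2)`, whose center may lie outside
the subgroup. The first estimate bounds `μ` above by a multiple of the spherical measure, and the
Vitali covering theorem for the second family of balls gives the reverse bound.
-/

section SphericalHausdorff

open Metric Set Topology

/-- The infimum of `∑ (2 r_j) ^ d` over the sequences of closed balls that cover `A` and satisfy
`2 r_j < ε`: the size-`ε` approximation of the spherical Hausdorff measure. -/
noncomputable def sphericalPremeasure {X : Type*} [PseudoMetricSpace X] (d ε : ℝ) (A : Set X) :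
    ℝ≥0∞ :=
  ⨅ (x : ℕ → X) (r : ℕ → ℝ) (_ : ∀ j, 0 ≤ r j ∧ 2 * r j < ε)
    (_ : A ⊆ ⋃ j, closedBall (x j) (r j)), ∑' j, ENNReal.ofReal (2 * r j) ^ d

/-- The spherical Hausdorff outer measure of dimension `d` of a metric space, without
normalization constant. -/
noncomputable def sphericalHausdorff {X : Type*} [PseudoMetricSpace X] (d : ℝ) (A : Set X) :
    ℝ≥0∞ :=
  ⨆ (ε : ℝ) (_ : 0 < ε), sphericalPremeasure d ε A

/-- The balls `B(p, r)`, encoded as pairs `(p, r)`, that lie in `U`, satisfy `2 r < ε` and have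
`μ`-density at least `η` in dimension `d`. -/
def denseBalls {X : Type*} [PseudoMetricSpace X] [MeasurableSpace X] (μ : Measure X) (d ε : ℝ)
    (η : ℝ≥0∞) (U : Set X) : Set (X × ℝ) :=
  {b | 0 < b.2 ∧ 2 * b.2 < ε ∧ closedBall b.1 b.2 ⊆ U ∧
    η * ENNReal.ofReal (2 * b.2) ^ d ≤ μ (closedBall b.1 b.2)}

variable {X : Type*} [PseudoMetricSpace X] {d ε R : ℝ}

theorem closedBall_subset_closedBall_of_dist_le {x p : X} {r : ℝ} (h : dist p x ≤ R * r) :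
    closedBall p r ⊆ closedBall x ((R + 1) * r) :=
  closedBall_subset_closedBall' (by linarith)

theorem sphericalPremeasure_mono {A B : Set X} (h : A ⊆ B) :
    sphericalPremeasure d ε A ≤ sphericalPremeasure d ε B :=
  iInf₂_mono fun _ _ => iInf_mono fun _ => iInf_mono' fun hB => ⟨h.trans hB, le_rfl⟩

theorem sphericalPremeasure_le_tsum [Nonempty X] {ι : Type*} [Countable ι] (hd : 0 < d)
    (hε : 0 < ε) {A : Set X} (x : ι → X) (r : ι → ℝ) (hr : ∀ i, 0 ≤ r i ∧ 2 * r i < ε)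
    (hA : A ⊆ ⋃ i, closedBall (x i) (r i)) :
    sphericalPremeasure d ε A ≤ ∑' i, ENNReal.ofReal (2 * r i) ^ d := by
  obtain ⟨f, hf⟩ := exists_injective_nat ι
  obtain ⟨x₀⟩ := ‹Nonempty X›
  have hsum : ∑' j, ENNReal.ofReal (2 * Function.extend f r 0 j) ^ d =
      ∑' i, ENNReal.ofReal (2 * r i) ^ d := by
    rw [← tsum_extend_zero hf]
    refine tsum_congr fun j => ?_
    by_cases hj : ∃ i, f i = j
    · obtain ⟨i, rfl⟩ := hj
      simp [hf.extend_apply]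
    · simp [Function.extend_apply' _ _ _ hj, hd]
  rw [← hsum]
  refine iInf₂_le_of_le (Function.extend f x fun _ => x₀) (Function.extend f r 0) <|
    iInf₂_le_of_le (fun j => ?_) (hA.trans (iUnion_subset fun i => ?_)) le_rfl
  · by_cases hj : ∃ i, f i = j
    · obtain ⟨i, rfl⟩ := hj
      simpa [hf.extend_apply] using hr i
    · simpa [Function.extend_apply' _ _ _ hj] using hε
  · refine subset_iUnion_of_subset (f i) ?_
    simp [hf.extend_apply]

theorem sphericalPremeasure_union_le [Nonempty X] (hd : 0 < d) (hε : 0 < ε) (A B : Set X) :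
    sphericalPremeasure d ε (A ∪ B) ≤ sphericalPremeasure d ε A + sphericalPremeasure d ε B := by
  conv_rhs => rw [sphericalPremeasure, sphericalPremeasure]
  simp only [ENNReal.iInf_add, ENNReal.add_iInf]
  refine le_iInf₂ fun y s => le_iInf₂ fun hs hB => le_iInf₂ fun x r => le_iInf₂ fun hr hA => ?_
  refine (sphericalPremeasure_le_tsum hd hε (Sum.elim x y) (Sum.elim r s) ?_ ?_).trans_eq
    (Summable.tsum_sum ENNReal.summable ENNReal.summable)
  · rintro (i | i)
    exacts [hr i, hs i]
  · rw [iUnion_sum]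
    exact union_subset_union hA hB

variable [MeasurableSpace X] {μ : Measure X} {η β : ℝ≥0∞} {A U : Set X}

theorem measure_closedBall_le_of_forall_pos (hβ : β ≠ ∞)
    (hupper : ∀ p r, 0 < r → μ (closedBall p r) ≤ β * ENNReal.ofReal (2 * r) ^ d) (p : X) {r : ℝ}
    (hr : 0 ≤ r) : μ (closedBall p r) ≤ β * ENNReal.ofReal (2 * r) ^ d := by
  have hcont : Continuous fun s : ℝ => β * ENNReal.ofReal (2 * s) ^ d :=
    (ENNReal.continuous_const_mul hβ).comp (ENNReal.continuous_rpow_const.comp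
      (ENNReal.continuous_ofReal.comp (continuous_const_mul 2)))
  refine ge_of_tendsto (hcont.continuousWithinAt (s := Ioi r) (x := r)) ?_
  filter_upwards [self_mem_nhdsWithin] with s (hs : r < s)
  exact (measure_mono (closedBall_subset_closedBall hs.le)).trans (hupper p s (hr.trans_lt hs))

theorem measure_le_mul_sphericalPremeasure (hβ0 : β ≠ 0) (hβ : β ≠ ∞)
    (hupper : ∀ p r, 0 < r → μ (closedBall p r) ≤ β * ENNReal.ofReal (2 * r) ^ d) :
    μ A ≤ β * sphericalPremeasure d ε A := by
  simp only [sphericalPremeasure, ENNReal.mul_iInf_of_ne hβ0 hβ]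
  refine le_iInf₂ fun x r => le_iInf₂ fun hr hA => ?_
  calc μ A ≤ ∑' j, μ (closedBall (x j) (r j)) := (measure_mono hA).trans (measure_iUnion_le _)
    _ ≤ ∑' j, β * ENNReal.ofReal (2 * r j) ^ d := ENNReal.tsum_le_tsum fun j =>
        measure_closedBall_le_of_forall_pos hβ hupper (x j) (hr j).1
    _ = β * ∑' j, ENNReal.ofReal (2 * r j) ^ d := ENNReal.tsum_mul_left

theorem mul_tsum_le_measure_of_subset_denseBalls [OpensMeasurableSpace X] {u : Set (X × ℝ)}
    (hu : u.Countable) (hdisj : u.PairwiseDisjoint fun b => closedBall b.1 b.2)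
    (hsub : u ⊆ denseBalls μ d ε η U) :
    η * ∑' b : u, ENNReal.ofReal (2 * b.1.2) ^ d ≤ μ U :=
  calc η * ∑' b : u, ENNReal.ofReal (2 * b.1.2) ^ d
      = ∑' b : u, η * ENNReal.ofReal (2 * b.1.2) ^ d := ENNReal.tsum_mul_left.symm
    _ ≤ ∑' b : u, μ (closedBall b.1.1 b.1.2) := ENNReal.tsum_le_tsum fun b => (hsub b.2).2.2.2
    _ = μ (⋃ b ∈ u, closedBall b.1 b.2) :=
        (measure_biUnion hu hdisj fun _ _ => measurableSet_closedBall).symm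
    _ ≤ μ U := measure_mono (iUnion₂_subset fun _ hb => (hsub hb).2.2.1)

theorem ofReal_mul_mul_rpow (hd : 0 ≤ d) {s : ℝ} (hs : 0 ≤ s) (r : ℝ) :
    ENNReal.ofReal (2 * (s * r)) ^ d = ENNReal.ofReal s ^ d * ENNReal.ofReal (2 * r) ^ d := by
  rw [mul_left_comm, ENNReal.ofReal_mul hs, ENNReal.mul_rpow_of_nonneg _ _ hd]

theorem exists_disjoint_subset_denseBalls_subset_enlargement [TopologicalSpace.SeparableSpace X]
    (hε : 0 < ε) (hU : IsOpen U) (hAU : A ⊆ U)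
    (hlower : ∀ x ∈ A, ∀ r, 0 < r → η * ENNReal.ofReal (2 * r) ^ d ≤ μ (closedBall x r)) :
    ∃ u ⊆ denseBalls μ d ε η U, u.Countable ∧ (u.PairwiseDisjoint fun b => closedBall b.1 b.2) ∧
      A ⊆ ⋃ b : u, closedBall b.1.1 (4 * b.1.2) := by
  obtain ⟨u, hsub, hdisj, hcover⟩ :=
    Vitali.exists_disjoint_subfamily_covering_enlargement_closedBall (denseBalls μ d ε η U)
      Prod.fst Prod.snd ε (fun b hb => by linarith [hb.1, hb.2.1]) 4 (by norm_num)
  refine ⟨u, hsub, hdisj.countable_of_nonempty_interior fun b hb =>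
    ⟨b.1, ball_subset_interior_closedBall (mem_ball_self (hsub hb).1)⟩, hdisj, fun x hx => ?_⟩
  obtain ⟨s, hs, hsU⟩ := nhds_basis_closedBall.mem_iff.1 (hU.mem_nhds (hAU hx))
  have hpos : 0 < min s (ε / 4) := by positivity
  have hmem : (x, min s (ε / 4)) ∈ denseBalls μ d ε η U :=
    ⟨hpos, by linarith [min_le_right s (ε / 4)],
      (closedBall_subset_closedBall (min_le_left _ _)).trans hsU, hlower x hx _ hpos⟩
  obtain ⟨b, hb, hxb⟩ := hcover _ hmem
  exact mem_iUnion.2 ⟨⟨b, hb⟩, hxb (mem_closedBall_self hpos.le)⟩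

theorem mul_sphericalPremeasure_le_of_centered_density [Nonempty X] [OpensMeasurableSpace X]
    [TopologicalSpace.SeparableSpace X] [μ.OuterRegular] (hd : 0 < d) (hε : 0 < ε)
    (hlower : ∀ x ∈ A, ∀ r, 0 < r → η * ENNReal.ofReal (2 * r) ^ d ≤ μ (closedBall x r)) :
    η * sphericalPremeasure d ε A ≤ ENNReal.ofReal 4 ^ d * μ A := by
  rw [A.measure_eq_iInf_isOpen μ]
  simp only [ENNReal.mul_iInf_of_ne (a := ENNReal.ofReal 4 ^ d) (by simp) (by simp)]
  refine le_iInf₂ fun U hAU => le_iInf fun hU => ?_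
  obtain ⟨u, hsub, hcount, hdisj, hcover⟩ :=
    exists_disjoint_subset_denseBalls_subset_enlargement (μ := μ) (ε := ε / 4) (by positivity)
      hU hAU hlower
  have : Countable u := hcount.to_subtype
  have hradius : ∀ b : u, 0 ≤ 4 * b.1.2 ∧ 2 * (4 * b.1.2) < ε := fun b => by
    obtain ⟨hpos, hlt, -⟩ := hsub b.2
    exact ⟨by positivity, by linarith⟩
  calc η * sphericalPremeasure d ε A
      ≤ η * ∑' b : u, ENNReal.ofReal (2 * (4 * b.1.2)) ^ d := by
        gcongr
        exact sphericalPremeasure_le_tsum hd hε _ _ hradius hcover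
    _ = ENNReal.ofReal 4 ^ d * (η * ∑' b : u, ENNReal.ofReal (2 * b.1.2) ^ d) := by
        simp only [ofReal_mul_mul_rpow hd.le zero_le_four, ENNReal.tsum_mul_left]
        ring
    _ ≤ ENNReal.ofReal 4 ^ d * μ U := by
        gcongr
        exact mul_tsum_le_measure_of_subset_denseBalls hcount hdisj hsub

theorem mul_rpow_le_measure_closedBall_of_dist_le (hd : 0 ≤ d) (hR : 0 ≤ R) {x : X}
    (hlower : ∀ r, 0 < r → ∃ p, dist p x ≤ R * r ∧
      η * ENNReal.ofReal (2 * r) ^ d ≤ μ (closedBall p r)) {r : ℝ} (hr : 0 < r) :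
    η * ENNReal.ofReal (R + 1)⁻¹ ^ d * ENNReal.ofReal (2 * r) ^ d ≤ μ (closedBall x r) := by
  obtain ⟨p, hp, hdense⟩ := hlower ((R + 1)⁻¹ * r) (by positivity)
  rw [mul_assoc, ← ofReal_mul_mul_rpow hd (by positivity)]
  refine hdense.trans (measure_mono ((closedBall_subset_closedBall_of_dist_le hp).trans_eq ?_))
  rw [mul_inv_cancel_left₀ (by positivity)]

theorem measure_closedBall_le_mul_of_dist_le (hd : 0 ≤ d) (hη0 : η ≠ 0) (hη : η ≠ ∞) (hR : 0 ≤ R)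
    (hupper : ∀ p r, 0 < r → μ (closedBall p r) ≤ β * ENNReal.ofReal (2 * r) ^ d) {r : ℝ}
    (hr : 0 < r) {p : X} (hdense : η * ENNReal.ofReal (2 * r) ^ d ≤ μ (closedBall p r)) (x : X) :
    μ (closedBall x (3 * ((R + 1) * r))) ≤
      β * ENNReal.ofReal (3 * (R + 1)) ^ d / η * μ (closedBall p r) :=
  calc μ (closedBall x (3 * ((R + 1) * r)))
      ≤ β * ENNReal.ofReal (2 * (3 * ((R + 1) * r))) ^ d := hupper _ _ (by positivity)
    _ = β * ENNReal.ofReal (3 * (R + 1)) ^ d / η * (η * ENNReal.ofReal (2 * r) ^ d) := by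
        rw [← mul_assoc (_ / η), ENNReal.div_mul_cancel hη0 hη, mul_assoc β,
          ← ofReal_mul_mul_rpow hd (by positivity), mul_assoc 3]
    _ ≤ β * ENNReal.ofReal (3 * (R + 1)) ^ d / η * μ (closedBall p r) := by gcongr

theorem exists_mem_denseBalls_of_lt (hε : 0 < ε) (hU : IsOpen U) (hR : 0 ≤ R) {x : X} (hx : x ∈ U)
    (hlower : ∀ r, 0 < r → ∃ p, dist p x ≤ R * r ∧
      η * ENNReal.ofReal (2 * r) ^ d ≤ μ (closedBall p r)) {s : ℝ} (hs : 0 < s) :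
    ∃ b ∈ denseBalls μ d ε η U, dist b.1 x ≤ R * b.2 ∧ (R + 1) * b.2 ≤ s := by
  obtain ⟨s', hs', hsU⟩ := nhds_basis_closedBall.mem_iff.1 (hU.mem_nhds hx)
  have hpos : 0 < min (min s s' / (R + 1)) (ε / 4) := by positivity
  obtain ⟨p, hp, hdense⟩ := hlower _ hpos
  have hle : (R + 1) * min (min s s' / (R + 1)) (ε / 4) ≤ min s s' := by
    calc (R + 1) * min (min s s' / (R + 1)) (ε / 4) ≤ (R + 1) * (min s s' / (R + 1)) := by
          gcongr
          exact min_le_left _ _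
      _ = min s s' := by field_simp
  refine ⟨(p, _), ⟨hpos, by linarith [min_le_right (min s s' / (R + 1)) (ε / 4)], ?_, hdense⟩, hp,
    hle.trans (min_le_left _ _)⟩
  exact (closedBall_subset_closedBall_of_dist_le hp).trans
    ((closedBall_subset_closedBall (hle.trans (min_le_right _ _))).trans hsU)

/-- The Vitali covering theorem applies although the dense balls are not centered on `A`, because
`hupper` and `hlower` make `μ` doubling along the balls used. -/
theorem exists_disjoint_subset_denseBalls_covering_ae [OpensMeasurableSpace X]
    [SecondCountableTopology X] [IsLocallyFiniteMeasure μ] (hd : 0 ≤ d) (hε : 0 < ε)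
    (hη0 : η ≠ 0) (hη : η ≠ ∞) (hβ : β ≠ ∞) (hU : IsOpen U) (hAU : A ⊆ U) (hR : 0 ≤ R)
    (hupper : ∀ p r, 0 < r → μ (closedBall p r) ≤ β * ENNReal.ofReal (2 * r) ^ d)
    (hlower : ∀ x ∈ A, ∀ r, 0 < r → ∃ p, dist p x ≤ R * r ∧
      η * ENNReal.ofReal (2 * r) ^ d ≤ μ (closedBall p r)) :
    ∃ u ⊆ denseBalls μ d ε η U, u.Countable ∧ (u.PairwiseDisjoint fun b => closedBall b.1 b.2) ∧
      μ (A \ ⋃ b ∈ u, closedBall b.1 b.2) = 0 := by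
  let t : Set (X × X × ℝ) := {a | a.2 ∈ denseBalls μ d ε η U ∧ dist a.2.1 a.1 ≤ R * a.2.2}
  have hC : β * ENNReal.ofReal (3 * (R + 1)) ^ d / η ≠ ∞ := by finiteness
  obtain ⟨u, hut, hcount, hdisj, hnull⟩ := Vitali.exists_disjoint_covering_ae μ A t
    (β * ENNReal.ofReal (3 * (R + 1)) ^ d / η).toNNReal (fun a => (R + 1) * a.2.2) Prod.fst
    (fun a => closedBall a.2.1 a.2.2)
    (fun a ha => closedBall_subset_closedBall_of_dist_le ha.2)
    (fun a ha => by
      rw [ENNReal.coe_toNNReal hC]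
      exact measure_closedBall_le_mul_of_dist_le hd hη0 hη hR hupper ha.1.1 ha.1.2.2.2 a.1)
    (fun a ha => ⟨_, ball_subset_interior_closedBall (mem_ball_self ha.1.1)⟩)
    (fun _ _ => isClosed_closedBall)
    (fun x hx s hs => by
      obtain ⟨b, hb, hdist, hle⟩ :=
        exists_mem_denseBalls_of_lt hε hU hR (hAU hx) (hlower x hx) hs
      exact ⟨(x, b), ⟨hb, hdist⟩, hle, rfl⟩)
  refine ⟨Prod.snd '' u, image_subset_iff.2 fun a ha => (hut ha).1, hcount.image _,
    Set.Pairwise.image hdisj, ?_⟩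
  rwa [biUnion_image]

theorem mul_sphericalPremeasure_le_measure [Nonempty X] [OpensMeasurableSpace X]
    [SecondCountableTopology X] [IsLocallyFiniteMeasure μ] [μ.OuterRegular] (hd : 0 < d)
    (hε : 0 < ε) (hη0 : η ≠ 0) (hη : η ≠ ∞) (hβ : β ≠ ∞) (hR : 0 ≤ R)
    (hupper : ∀ p r, 0 < r → μ (closedBall p r) ≤ β * ENNReal.ofReal (2 * r) ^ d)
    (hlower : ∀ x ∈ A, ∀ r, 0 < r → ∃ p, dist p x ≤ R * r ∧
      η * ENNReal.ofReal (2 * r) ^ d ≤ μ (closedBall p r)) :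
    η * sphericalPremeasure d ε A ≤ μ A := by
  rw [A.measure_eq_iInf_isOpen μ]
  refine le_iInf₂ fun U hAU => le_iInf fun hU => ?_
  obtain ⟨u, hsub, hcount, hdisj, hnull⟩ :=
    exists_disjoint_subset_denseBalls_covering_ae hd.le hε hη0 hη hβ hU hAU hR hupper hlower
  have : Countable u := hcount.to_subtype
  set V : Set X := ⋃ b ∈ u, closedBall b.1 b.2
  have hrest : sphericalPremeasure d ε (A \ V) = 0 := by
    have hle := mul_sphericalPremeasure_le_of_centered_density hd hε fun x (hx : x ∈ A \ V) _ hr =>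
      mul_rpow_le_measure_closedBall_of_dist_le hd.le hR (hlower x hx.1) hr
    rw [hnull, mul_zero, nonpos_iff_eq_zero] at hle
    refine (mul_eq_zero.1 hle).resolve_left (mul_ne_zero hη0 ?_)
    have : 0 < R + 1 := by positivity
    simp [ENNReal.rpow_eq_zero_iff, this.not_ge]
  calc η * sphericalPremeasure d ε A
      ≤ η * (sphericalPremeasure d ε (A \ V) + sphericalPremeasure d ε V) := by
        gcongr
        refine (sphericalPremeasure_mono ?_).trans (sphericalPremeasure_union_le hd hε _ _)
        rw [sdiff_union_self]
        exact subset_union_left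
    _ ≤ η * ∑' b : u, ENNReal.ofReal (2 * b.1.2) ^ d := by
        rw [hrest, zero_add]
        gcongr
        exact sphericalPremeasure_le_tsum hd hε (fun b : u => b.1.1) (fun b => b.1.2)
          (fun b => ⟨(hsub b.2).1.le, (hsub b.2).2.1⟩) (biUnion_eq_iUnion _ _).subset
    _ ≤ μ U := mul_tsum_le_measure_of_subset_denseBalls hcount hdisj hsub

theorem mul_sphericalHausdorff_eq_measure [Nonempty X] [OpensMeasurableSpace X]
    [SecondCountableTopology X] [IsLocallyFiniteMeasure μ] [μ.OuterRegular] (hd : 0 < d)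
    (hβ0 : β ≠ 0) (hβ : β ≠ ∞)
    (hupper : ∀ p r, 0 < r → μ (closedBall p r) ≤ β * ENNReal.ofReal (2 * r) ^ d)
    (hlower : ∀ η < β, ∃ R : ℝ, ∀ x ∈ A, ∀ r, 0 < r → ∃ p, dist p x ≤ R * r ∧
      η * ENNReal.ofReal (2 * r) ^ d ≤ μ (closedBall p r)) :
    β * sphericalHausdorff d A = μ A := by
  refine le_antisymm ?_ ((measure_le_mul_sphericalPremeasure hβ0 hβ hupper).trans
    (mul_le_mul_right (le_iSup₂_of_le 1 one_pos le_rfl) β))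
  simp only [sphericalHausdorff, ENNReal.mul_iSup]
  refine iSup₂_le fun ε hε => ENNReal.mul_le_of_forall_lt fun η hη b hb => ?_
  rcases eq_or_ne η 0 with rfl | hη0
  · simp
  obtain ⟨R, hR⟩ := hlower η hη
  refine (mul_le_mul_right hb.le η).trans (mul_sphericalPremeasure_le_measure hd hε hη0 hη.ne_top
    hβ (le_max_right R 0) hupper fun x hx r hr => ?_)
  obtain ⟨p, hp, hdense⟩ := hR x hx r hr
  exact ⟨p, hp.trans (by gcongr; exact le_max_left _ _), hdense⟩

end SphericalHausdorff

theorem div_two_pow_mul_ofReal_rpow (b : ℝ≥0∞) (m : ℕ) (r : ℝ) :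
    b / 2 ^ m * ENNReal.ofReal (2 * r) ^ (m : ℝ) = ENNReal.ofReal r ^ m * b := by
  rw [ENNReal.rpow_natCast, ENNReal.ofReal_mul two_pos.le, mul_pow, ENNReal.ofReal_ofNat,
    ← mul_assoc, ENNReal.div_mul_cancel (by simp) (by simp), mul_comm]

theorem volume_preimage_shear {α : Type*} [MeasureSpace α] [SFinite (volume : Measure α)]
    {g : α → ℝ} (hg : Measurable g) (S : Set (α × ℝ)) :
    volume ((fun x : α × ℝ => (x.1, x.2 + g x.1)) ⁻¹' S) = volume S := by
  let e : α × ℝ ≃ᵐ α × ℝ :=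
    { toFun := fun x => (x.1, x.2 + g x.1)
      invFun := fun x => (x.1, x.2 - g x.1)
      left_inv := fun x => by simp
      right_inv := fun x => by simp
      measurable_toFun := by dsimp; fun_prop
      measurable_invFun := by dsimp; fun_prop }
  have he : MeasurePreserving e :=
    (MeasurePreserving.id volume).skew_product (g := fun a t => t + g a) (by fun_prop) <|
      .of_forall fun a => map_add_right_eq_self volume (g a)
  exact he.measure_preimage_equiv S

theorem exists_linearIsometry_comp_eq {F E : Type*} [NormedAddCommGroup F] [InnerProductSpace ℝ F]
    [NormedAddCommGroup E] [InnerProductSpace ℝ E] [FiniteDimensional ℝ E]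
    (i j : F →ₗᵢ[ℝ] E) : ∃ U : E →ₗᵢ[ℝ] E, U.comp i = j := by
  let L := j.comp i.equivRange.symm.toLinearIsometry
  refine ⟨L.extend, LinearIsometry.ext fun u => ?_⟩
  simpa [L] using L.extend_apply (i.equivRange u)

theorem exists_linearIsometry_range_eq {F E : Type*} [NormedAddCommGroup F]
    [InnerProductSpace ℝ F] [FiniteDimensional ℝ F] [NormedAddCommGroup E] [InnerProductSpace ℝ E]
    {W : Submodule ℝ E} [FiniteDimensional ℝ W] (hW : Module.finrank ℝ W = Module.finrank ℝ F) :
    ∃ i : F →ₗᵢ[ℝ] E, i.toLinearMap.range = W := by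
  let e : F ≃ₗᵢ[ℝ] W :=
    (stdOrthonormalBasis ℝ F).equiv (stdOrthonormalBasis ℝ W) (finCongr hW.symm)
  refine ⟨W.subtypeₗᵢ.comp e.toLinearIsometry, ?_⟩
  ext z
  exact ⟨by rintro ⟨u, rfl⟩; exact (e u).2, fun hz => ⟨e.symm ⟨z, hz⟩, by simp⟩⟩

theorem nonempty_linearIsometry_of_finrank_le {F E : Type*} [NormedAddCommGroup F]
    [InnerProductSpace ℝ F] [FiniteDimensional ℝ F] [NormedAddCommGroup E] [InnerProductSpace ℝ E]
    [FiniteDimensional ℝ E] (h : Module.finrank ℝ F ≤ Module.finrank ℝ E) :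
    Nonempty (F →ₗᵢ[ℝ] E) := by
  obtain ⟨f, hf⟩ := finrank_le_iff_exists_linearMap.1 h
  obtain ⟨i, -⟩ := exists_linearIsometry_range_eq (LinearMap.finrank_range_of_inj hf)
  exact ⟨i⟩

namespace Heis

open Metric Set Filter Topology Module

/-- The horizontal layer `ℝ²ⁿ` of `ℍⁿ`. -/
abbrev Horizontal (n : ℕ) := EuclideanSpace ℝ (Fin n ⊕ Fin n)

variable {n : ℕ}

theorem symp_smul_right (a b : Horizontal n) (l : ℝ) : symp a (l • b) = l * symp a b := by
  simp only [symp, Finset.mul_sum, PiLp.smul_apply, smul_eq_mul]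
  exact Finset.sum_congr rfl fun j _ => by ring

theorem symp_neg_right (a b : Horizontal n) : symp a (-b) = -symp a b := by
  rw [← neg_one_smul ℝ b, symp_smul_right, neg_one_mul]

theorem symp_self (a : Horizontal n) : symp a a = 0 := by
  simp [symp]

theorem symp_zero_right (a : Horizontal n) : symp a 0 = 0 := by
  simp [symp]

@[fun_prop]
theorem continuous_symp (a : Horizontal n) : Continuous (symp a) := by
  unfold symp
  fun_prop

theorem mk_mul_mk (z z' : Horizontal n) (t t' : ℝ) :
    (⟨z, t⟩ * ⟨z', t'⟩ : Heis n) = ⟨z + z', t + t' + 1 / 2 * symp z z'⟩ :=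
  rfl

theorem IsVertical.mem_of_z_eq {P : Subgroup (Heis n)} (hP : IsVertical P) {p q : Heis n}
    (hp : p ∈ P) (h : p.z = q.z) : q ∈ P := by
  have hq : q = p * ⟨0, q.t - p.t⟩ := by
    ext1 <;> simp [h, symp_zero_right]
  rw [hq]
  exact P.mul_mem hp (hP.2 _)

theorem IsVertical.mem_smul_of_pos {P : Subgroup (Heis n)} (hP : IsVertical P) {z : Horizontal n}
    (hz : (⟨z, 0⟩ : Heis n) ∈ P) {l : ℝ} (hl : 0 < l) : (⟨l • z, 0⟩ : Heis n) ∈ P := by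
  have hdil : dil l ⟨z, 0⟩ ∈ (P : Set (Heis n)) := hP.1 l hl ▸ mem_image_of_mem _ hz
  exact hP.mem_of_z_eq hdil rfl

theorem IsVertical.exists_submodule {P : Subgroup (Heis n)} (hP : IsVertical P) :
    ∃ W : Submodule ℝ (Horizontal n), ∀ p, p ∈ P ↔ p.z ∈ W := by
  refine ⟨{ carrier := {z | (⟨z, 0⟩ : Heis n) ∈ P}
            add_mem' := fun ha hb => hP.mem_of_z_eq (P.mul_mem ha hb) rfl
            zero_mem' := P.one_mem
            smul_mem' := fun l z hz => ?_ },
    fun p => ⟨fun hp => hP.mem_of_z_eq hp rfl, fun hp => hP.mem_of_z_eq hp rfl⟩⟩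
  rcases lt_trichotomy l 0 with hl | rfl | hl
  · exact hP.mem_of_z_eq (P.inv_mem (hP.mem_smul_of_pos hz (neg_pos.2 hl))) (by simp)
  · exact hP.mem_of_z_eq P.one_mem (by simp)
  · exact hP.mem_smul_of_pos hz hl

theorem topDim_eq_finrank_add_one {P : Subgroup (Heis n)} {W : Submodule ℝ (Horizontal n)}
    (hW : ∀ p, p ∈ P ↔ p.z ∈ W) : topDim P = finrank ℝ W + 1 := by
  let e := (WithLp.linearEquiv 2 ℝ (Horizontal n × ℝ)).symm
  let f : W × ℝ →ₗ[ℝ] WithLp 2 (Horizontal n × ℝ) := e.toLinearMap ∘ₗ W.subtype.prodMap .id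
  have hf : Function.Injective f :=
    e.injective.comp (W.injective_subtype.prodMap Function.injective_id)
  have himage : toEuclidean '' (P : Set (Heis n)) = LinearMap.range f := by
    ext x
    constructor
    · rintro ⟨p, hp, rfl⟩
      exact ⟨(⟨p.z, (hW p).1 hp⟩, p.t), rfl⟩
    · rintro ⟨⟨⟨z, hz⟩, t⟩, rfl⟩
      exact ⟨⟨z, t⟩, (hW _).2 hz, rfl⟩
  rw [topDim, himage, Submodule.span_eq, LinearMap.finrank_range_of_inj hf, finrank_prod,
    finrank_self]

theorem IsVertical.exists_submodule_of_topDim_eq {k : ℕ} {P : Subgroup (Heis n)}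
    (hP : IsVertical P) (hdim : topDim P = 2 * n + 1 - k) :
    ∃ W : Submodule ℝ (Horizontal n), finrank ℝ W + k = 2 * n ∧ ∀ p, p ∈ P ↔ p.z ∈ W := by
  obtain ⟨W, hW⟩ := hP.exists_submodule
  rw [topDim_eq_finrank_add_one hW] at hdim
  exact ⟨W, by omega, hW⟩

section HomogeneousMorphism

variable {k : ℕ} {L : Heis n → EuclideanSpace ℝ (Fin k)}

/-- `δ₂(0, t) = (0, t)⁴`, so `L(0, t)` is multiplied by `2` and by `4`. -/
theorem IsHomogeneousMorphism.map_center (hL : IsHomogeneousMorphism L) (t : ℝ) :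
    L ⟨0, t⟩ = 0 := by
  have hdil : dil 2 (⟨0, t⟩ : Heis n) = (⟨0, t⟩ * ⟨0, t⟩) * (⟨0, t⟩ * ⟨0, t⟩) := by
    ext1
    · simp [dil]
    · simp only [dil, mk_mul_mk, symp_zero_right, add_zero]
      ring
  have h := congrArg L hdil
  rw [hL.map_dil 2 two_pos, hL.map_mul, hL.map_mul, two_smul, left_eq_add, ← two_smul ℝ] at h
  exact (smul_eq_zero_iff_right two_ne_zero).1 h

theorem IsHomogeneousMorphism.map_eq_map_horizontal (hL : IsHomogeneousMorphism L) (p : Heis n) :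
    L p = L ⟨p.z, 0⟩ := by
  have hp : p = ⟨p.z, 0⟩ * ⟨0, p.t⟩ := by
    ext1 <;> simp [symp_zero_right]
  conv_lhs => rw [hp, hL.map_mul, hL.map_center, add_zero]

theorem IsHomogeneousMorphism.exists_linearMap (hL : IsHomogeneousMorphism L) :
    ∃ l : Horizontal n →ₗ[ℝ] EuclideanSpace ℝ (Fin k), ∀ p, L p = l p.z := by
  have hadd : ∀ a b, L ⟨a + b, 0⟩ = L ⟨a, 0⟩ + L ⟨b, 0⟩ := fun a b => by
    rw [← hL.map_mul, hL.map_eq_map_horizontal (_ * _), mul_z]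
  have hpos : ∀ c : ℝ, 0 < c → ∀ a, L ⟨c • a, 0⟩ = c • L ⟨a, 0⟩ := fun c hc a => by
    rw [← hL.map_dil c hc, hL.map_eq_map_horizontal (dil c _)]
    rfl
  have hneg : ∀ a, L ⟨-a, 0⟩ = -L ⟨a, 0⟩ := fun a => by
    rw [eq_neg_iff_add_eq_zero, ← hadd, neg_add_cancel, hL.map_center]
  refine ⟨{ toFun := fun z => L ⟨z, 0⟩
            map_add' := hadd
            map_smul' := fun c a => ?_ }, hL.map_eq_map_horizontal⟩
  rw [RingHom.id_apply]
  rcases lt_trichotomy c 0 with hc | rfl | hc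
  · rw [← neg_neg c, neg_smul, hneg, hpos _ (neg_pos.2 hc), neg_smul (-c)]
  · rw [zero_smul, zero_smul, hL.map_center]
  · exact hpos c hc a

end HomogeneousMorphism

theorem exists_submodule_of_mem_tangentSubgroups {k : ℕ} {P : Subgroup (Heis n)}
    (hP : P ∈ tangentSubgroups n k) :
    ∃ W : Submodule ℝ (Horizontal n), finrank ℝ W + k = 2 * n ∧ ∀ p, p ∈ P ↔ p.z ∈ W := by
  obtain ⟨-, -, L, hL, hsurj, hker⟩ := hP
  obtain ⟨l, hl⟩ := hL.exists_linearMap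
  refine ⟨LinearMap.ker l, ?_, fun p => by rw [hker, hl, LinearMap.mem_ker]⟩
  have hrange : LinearMap.range l = ⊤ := LinearMap.range_eq_top.2 fun y =>
    (hsurj y).imp' Heis.z fun p hp => (hl p).symm.trans hp
  have hrank := l.finrank_range_add_finrank_ker
  rw [hrange, finrank_top, finrank_euclideanSpace, finrank_euclideanSpace, Fintype.card_sum,
    Fintype.card_fin, Fintype.card_fin] at hrank
  omega

namespace IsHomogeneousDistance

variable {ρ : Heis n → Heis n → ℝ}

theorem dist_mul_right (hρ : IsHomogeneousDistance ρ) (p q : Heis n) :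
    ρ p (p * q) = ρ 1 q := by
  simpa only [mul_one] using hρ.left_invariant p 1 q

theorem dist_eq_dist_one (hρ : IsHomogeneousDistance ρ) (p q : Heis n) :
    ρ p q = ρ 1 ⟨q.z - p.z, q.t - p.t - 1 / 2 * symp p.z q.z⟩ := by
  rw [← hρ.dist_mul_right p]
  congr 1
  ext1
  · simp
  · simp only [mul_t, sub_eq_add_neg q.z, symp_add_right, symp_neg_right, symp_self]
    ring

theorem dist_one_mul_le (hρ : IsHomogeneousDistance ρ) (p q : Heis n) :
    ρ 1 (p * q) ≤ ρ 1 p + ρ 1 q := by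
  rw [← hρ.dist_mul_right p q]
  exact hρ.triangle 1 p (p * q)

theorem dist_one_inv (hρ : IsHomogeneousDistance ρ) (p : Heis n) : ρ 1 p⁻¹ = ρ 1 p := by
  rw [← hρ.dist_mul_right p, mul_inv_cancel, hρ.symm]

theorem dist_one_dil (hρ : IsHomogeneousDistance ρ) {l : ℝ} (hl : 0 < l) (p : Heis n) :
    ρ 1 (dil l p) = l * ρ 1 p := by
  rw [← hρ.homogeneous l hl]
  congr 1
  ext1 <;> simp [dil]

theorem dist_one_pos (hρ : IsHomogeneousDistance ρ) {p : Heis n} (hp : p ≠ 1) : 0 < ρ 1 p :=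
  (hρ.nonneg 1 p).lt_of_ne' fun h => hp ((hρ.eq_zero_iff 1 p).1 h).symm

theorem exists_dist_one_horizontal_eq (hρ : IsHomogeneousDistance ρ)
    (hrot : IsRotationallyInvariant ρ) : ∃ K : ℝ, 0 < K ∧ ∀ z, ρ 1 ⟨z, 0⟩ = K * ‖z‖ := by
  have hzero : ρ 1 ⟨0, 0⟩ = 0 := (hρ.eq_zero_iff 1 1).2 rfl
  rcases subsingleton_or_nontrivial (Horizontal n) with _ | _
  · exact ⟨1, one_pos, fun z => by rw [Subsingleton.elim z 0, hzero, norm_zero, mul_zero]⟩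
  obtain ⟨e, he⟩ := exists_norm_eq (Horizontal n) zero_le_one
  have he0 : e ≠ 0 := norm_ne_zero_iff.1 (he ▸ one_ne_zero)
  refine ⟨ρ 1 ⟨e, 0⟩, hρ.dist_one_pos fun h => he0 (congrArg Heis.z h), fun z => ?_⟩
  rcases eq_or_ne z 0 with rfl | hz
  · rw [hzero, norm_zero, mul_zero]
  · rw [mul_comm, ← hρ.dist_one_dil (norm_pos_iff.2 hz), dil, mul_zero]
    exact hrot _ _ _ (by rw [norm_smul, he, mul_one, norm_norm])

theorem exists_dist_one_vertical_eq (hρ : IsHomogeneousDistance ρ) :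
    ∃ K : ℝ, 0 < K ∧ ∀ t, ρ 1 ⟨0, t⟩ = K * √|t| := by
  have hpos : ∀ t : ℝ, 0 < t → ρ 1 ⟨0, t⟩ = ρ 1 ⟨0, 1⟩ * √|t| := fun t ht => by
    rw [mul_comm, ← hρ.dist_one_dil (Real.sqrt_pos.2 (abs_pos.2 ht.ne'))]
    simp [dil, abs_of_pos ht, ht.le]
  refine ⟨ρ 1 ⟨0, 1⟩, hρ.dist_one_pos fun h => one_ne_zero (congrArg Heis.t h), fun t => ?_⟩
  rcases lt_trichotomy t 0 with ht | rfl | ht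
  · have hinv : (⟨0, t⟩ : Heis n) = ⟨0, -t⟩⁻¹ := by
      ext1 <;> simp
    rw [hinv, hρ.dist_one_inv, hpos (-t) (neg_pos.2 ht), abs_neg]
  · rw [abs_zero, Real.sqrt_zero, mul_zero]
    exact (hρ.eq_zero_iff 1 1).2 rfl
  · exact hpos t ht

theorem dist_one_horizontal_le (hρ : IsHomogeneousDistance ρ) (hrot : IsRotationallyInvariant ρ)
    (p : Heis n) : ρ 1 ⟨p.z, 0⟩ ≤ ρ 1 p := by
  have hreflect : ρ 1 ⟨p.z, -p.t⟩ = ρ 1 p := by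
    rw [← hρ.dist_one_inv p]
    exact hrot _ _ _ (norm_neg p.z).symm
  have hdouble : p * ⟨p.z, -p.t⟩ = dil 2 ⟨p.z, 0⟩ := by
    ext1
    · simp [dil, two_smul]
    · simp [dil, symp_self]
  have h := hρ.dist_one_mul_le p ⟨p.z, -p.t⟩
  rw [hdouble, hρ.dist_one_dil two_pos, hreflect] at h
  linarith

theorem exists_norm_z_le (hρ : IsHomogeneousDistance ρ) (hrot : IsRotationallyInvariant ρ) :
    ∃ K : ℝ, 0 < K ∧ ∀ p : Heis n, ‖p.z‖ ≤ K * ρ 1 p := by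
  obtain ⟨K, hK, h⟩ := hρ.exists_dist_one_horizontal_eq hrot
  refine ⟨K⁻¹, inv_pos.2 hK, fun p => ?_⟩
  rw [le_inv_mul_iff₀ hK, ← h]
  exact hρ.dist_one_horizontal_le hrot p

theorem exists_abs_t_le (hρ : IsHomogeneousDistance ρ) (hrot : IsRotationallyInvariant ρ) :
    ∃ K : ℝ, 0 < K ∧ ∀ p : Heis n, |p.t| ≤ (K * ρ 1 p) ^ 2 := by
  obtain ⟨K, hK, h⟩ := hρ.exists_dist_one_vertical_eq
  refine ⟨K⁻¹ * 2, by positivity, fun p => ?_⟩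
  have hvertical : (⟨0, p.t⟩ : Heis n) = p * ⟨-p.z, 0⟩ := by
    ext1
    · simp
    · simp [symp_neg_right, symp_self]
  have hle : K * √|p.t| ≤ 2 * ρ 1 p := by
    rw [← h, hvertical, two_mul]
    refine (hρ.dist_one_mul_le _ _).trans (add_le_add_right ?_ _)
    rw [hrot _ p.z 0 (norm_neg p.z)]
    exact hρ.dist_one_horizontal_le hrot p
  have := hρ.nonneg 1 p
  rw [← Real.sqrt_le_left (by positivity), mul_assoc, le_inv_mul_iff₀ hK]
  exact hle

theorem exists_dist_one_le (hρ : IsHomogeneousDistance ρ) (hrot : IsRotationallyInvariant ρ) :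
    ∃ K₁ K₂ : ℝ, ∀ z t, ρ 1 ⟨z, t⟩ ≤ K₁ * ‖z‖ + K₂ * √|t| := by
  obtain ⟨K₁, -, h₁⟩ := hρ.exists_dist_one_horizontal_eq hrot
  obtain ⟨K₂, -, h₂⟩ := hρ.exists_dist_one_vertical_eq
  refine ⟨K₁, K₂, fun z t => ?_⟩
  have h := hρ.dist_one_mul_le ⟨z, 0⟩ ⟨0, t⟩
  rwa [mk_mul_mk, symp_zero_right, mul_zero, add_zero, add_zero, zero_add, h₁, h₂] at h

/-- The metric space structure on `ℍⁿ` whose distance is a given homogeneous distance. It is not an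
instance, since it depends on the distance. -/
abbrev metricSpace (hρ : IsHomogeneousDistance ρ) : MetricSpace (Heis n) where
  dist := ρ
  dist_self p := (hρ.eq_zero_iff p p).2 rfl
  dist_comm := hρ.symm
  dist_triangle := hρ.triangle
  eq_of_dist_eq_zero h := (hρ.eq_zero_iff _ _).1 h

theorem closedBall_eq_cBall (hρ : IsHomogeneousDistance ρ) (p : Heis n) (r : ℝ) :
    let _ := hρ.metricSpace
    closedBall p r = cBall ρ p r := by
  let _ := hρ.metricSpace
  ext q
  rw [mem_closedBall, dist_comm]
  rfl

theorem sphericalHausdorff_eq_sphericalMeasure (hρ : IsHomogeneousDistance ρ) (d : ℝ)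
    (A : Set (Heis n)) :
    let _ := hρ.metricSpace
    sphericalHausdorff d A = sphericalMeasure ρ d A := by
  simp only [sphericalHausdorff, sphericalPremeasure, sphericalMeasure, hρ.closedBall_eq_cBall]

theorem continuous_z (hρ : IsHomogeneousDistance ρ) (hrot : IsRotationallyInvariant ρ) :
    let _ := hρ.metricSpace
    Continuous (Heis.z : Heis n → Horizontal n) := by
  let _ := hρ.metricSpace
  obtain ⟨K, -, hK⟩ := hρ.exists_norm_z_le hrot
  have hdist : ∀ p q, dist p.z q.z ≤ K * ρ p q := fun p q => by
    rw [hρ.dist_eq_dist_one, dist_comm, dist_eq_norm]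
    exact hK ⟨_, _⟩
  exact (LipschitzWith.of_dist_le' hdist).continuous

theorem continuous_t (hρ : IsHomogeneousDistance ρ) (hrot : IsRotationallyInvariant ρ) :
    let _ := hρ.metricSpace
    Continuous (Heis.t : Heis n → ℝ) := by
  let _ := hρ.metricSpace
  have hz : Continuous (Heis.z : Heis n → Horizontal n) := hρ.continuous_z hrot
  obtain ⟨K, -, hK⟩ := hρ.exists_abs_t_le hrot
  refine continuous_iff_continuousAt.2 fun p => ?_
  have hbound : ∀ q, |q.t - p.t - 1 / 2 * symp p.z q.z| ≤ (K * ρ p q) ^ 2 := fun q => by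
    rw [hρ.dist_eq_dist_one]
    exact hK ⟨_, _⟩
  have hdist : Tendsto (fun q => (K * dist p q) ^ 2) (𝓝 p) (𝓝 0) :=
    Continuous.tendsto' (by fun_prop) p 0 (by simp)
  have hlinear : Tendsto (fun q : Heis n => p.t + 1 / 2 * symp p.z q.z) (𝓝 p) (𝓝 p.t) :=
    Continuous.tendsto' (by fun_prop) p p.t (by simp [symp_self])
  have h := (squeeze_zero_norm hbound hdist).add hlinear
  rw [zero_add] at h
  refine h.congr fun q => ?_
  ring

theorem continuous_ofEuclidean (hρ : IsHomogeneousDistance ρ) (hrot : IsRotationallyInvariant ρ) :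
    let _ := hρ.metricSpace
    Continuous fun x : WithLp 2 (Horizontal n × ℝ) => (⟨x.fst, x.snd⟩ : Heis n) := by
  let _ := hρ.metricSpace
  obtain ⟨K₁, K₂, hK⟩ := hρ.exists_dist_one_le hrot
  refine continuous_iff_continuousAt.2 fun x => tendsto_iff_dist_tendsto_zero.2 ?_
  have hcont : Continuous fun y : WithLp 2 (Horizontal n × ℝ) =>
      K₁ * ‖y.fst - x.fst‖ + K₂ * √|y.snd - x.snd - 1 / 2 * symp x.fst y.fst| := by
    fun_prop
  refine squeeze_zero (fun _ => dist_nonneg) (fun y => ?_)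
    (hcont.tendsto' x 0 (by simp [symp_self]))
  rw [dist_comm]
  exact (hρ.dist_eq_dist_one _ _).trans_le (hK _ _)

theorem isHomeomorph_toEuclidean (hρ : IsHomogeneousDistance ρ)
    (hrot : IsRotationallyInvariant ρ) :
    let _ := hρ.metricSpace
    IsHomeomorph (toEuclidean : Heis n → WithLp 2 (Horizontal n × ℝ)) := by
  let _ := hρ.metricSpace
  exact isHomeomorph_iff_exists_inverse.2
    ⟨(WithLp.prod_continuous_toLp 2 _ _).comp
      ((hρ.continuous_z hrot).prodMk (hρ.continuous_t hrot)),
    fun x => ⟨x.fst, x.snd⟩, fun _ => rfl, fun _ => rfl, hρ.continuous_ofEuclidean hrot⟩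

end IsHomogeneousDistance

section Slices

variable {ρ : Heis n → Heis n → ℝ} {F : Type*} [NormedAddCommGroup F] [InnerProductSpace ℝ F]

/-- The parametrization by `F × ℝ` of the vertical subgroup `i(F) × ℝ` of `ℍⁿ`. -/
noncomputable def verticalParam (i : F →ₗᵢ[ℝ] Horizontal n) (x : F × ℝ) : Heis n :=
  ⟨i x.1, x.2⟩

/-- The points `(u, t)` of `F × ℝ` for which `(i u - w, t)` is in the closed ball of radius `r`
around the identity. Up to a shear, this is the part in `i(F) × ℝ` of a ball of radius `r` whose
center has horizontal component `w`. -/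
def ballSlice (ρ : Heis n → Heis n → ℝ) (i : F →ₗᵢ[ℝ] Horizontal n) (w : Horizontal n) (r : ℝ) :
    Set (F × ℝ) :=
  {x | ρ 1 ⟨i x.1 - w, x.2⟩ ≤ r}

theorem ballSlice_comp (hrot : IsRotationallyInvariant ρ) (U : Horizontal n →ₗᵢ[ℝ] Horizontal n)
    (i : F →ₗᵢ[ℝ] Horizontal n) (w : Horizontal n) (r : ℝ) :
    ballSlice ρ (U.comp i) (U w) r = ballSlice ρ i w r := by
  ext x
  have hnorm : ‖U (i x.1) - U w‖ = ‖i x.1 - w‖ := by rw [← map_sub, U.norm_map]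
  simp only [ballSlice, mem_ofPred_eq, LinearIsometry.coe_comp, Function.comp_apply,
    hrot _ _ x.2 hnorm]

theorem exists_ballSlice_subset (hρ : IsHomogeneousDistance ρ) (hrot : IsRotationallyInvariant ρ) :
    ∃ s T : ℝ, ∀ (i : F →ₗᵢ[ℝ] Horizontal n) (w : Horizontal n), ∃ c : F,
      ballSlice ρ i w 1 ⊆ closedBall c s ×ˢ closedBall 0 T := by
  obtain ⟨K, hK, hz⟩ := hρ.exists_norm_z_le hrot
  obtain ⟨M, hM, ht⟩ := hρ.exists_abs_t_le hrot
  refine ⟨K + K, M ^ 2, fun i w => ?_⟩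
  have hnorm : ∀ x ∈ ballSlice ρ i w 1, ‖i x.1 - w‖ ≤ K := fun x hx =>
    (hz ⟨_, _⟩).trans (mul_le_of_le_one_right hK.le hx)
  rcases (ballSlice ρ i w 1).eq_empty_or_nonempty with hempty | ⟨c, hc⟩
  · exact ⟨0, hempty ▸ empty_subset _⟩
  refine ⟨c.1, fun x hx => ⟨?_, ?_⟩⟩
  · rw [mem_closedBall, ← i.dist_map]
    refine (dist_triangle_right _ _ w).trans (add_le_add ?_ ?_)
    · exact (dist_eq_norm _ _).trans_le (hnorm x hx)
    · exact (dist_eq_norm _ _).trans_le (hnorm c hc)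
  · rw [mem_closedBall_zero_iff, Real.norm_eq_abs]
    refine (ht ⟨i x.1 - w, x.2⟩).trans (pow_le_pow_left₀ ?_ ?_ 2)
    · exact mul_nonneg hM.le (hρ.nonneg _ _)
    · exact mul_le_of_le_one_right hM.le hx

theorem isometry_toEuclidean_verticalParam (i : F →ₗᵢ[ℝ] Horizontal n) :
    Isometry fun x : WithLp 2 (F × ℝ) => toEuclidean (verticalParam i (WithLp.ofLp x)) :=
  Isometry.of_dist_eq fun x y => by
    simp [toEuclidean, verticalParam, WithLp.prod_dist_eq_of_L2, i.isometry.dist_eq]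

variable [FiniteDimensional ℝ F]

theorem isClosedEmbedding_verticalParam (hρ : IsHomogeneousDistance ρ)
    (hrot : IsRotationallyInvariant ρ) (i : F →ₗᵢ[ℝ] Horizontal n) :
    letI := hρ.metricSpace
    IsClosedEmbedding (verticalParam i) := by
  let _ := hρ.metricSpace
  have : CompleteSpace (WithLp 2 (F × ℝ)) := FiniteDimensional.complete ℝ _
  have hcomp : IsClosedEmbedding (toEuclidean ∘ verticalParam i) :=
    (isometry_toEuclidean_verticalParam i).isClosedEmbedding.comp
      (WithLp.homeomorphProd 2 F ℝ).symm.isClosedEmbedding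
  exact ((hρ.isHomeomorph_toEuclidean hrot).isClosedEmbedding.of_comp_iff).1 hcomp

variable [MeasurableSpace F] [BorelSpace F]

theorem euclideanMeasure_image_verticalParam (i : F →ₗᵢ[ℝ] Horizontal n) (T : Set (F × ℝ)) :
    euclideanMeasure (finrank ℝ F + 1) (verticalParam i '' T) = volume T := by
  have himage : toEuclidean '' (verticalParam i '' T) =
      (fun x => toEuclidean (verticalParam i (WithLp.ofLp x))) '' (WithLp.toLp 2 '' T) := by
    simp only [image_image]
  have hdim : finrank ℝ (WithLp 2 (F × ℝ)) = finrank ℝ F + 1 := by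
    rw [(WithLp.linearEquiv 2 ℝ (F × ℝ)).finrank_eq, finrank_prod, finrank_self]
  rw [euclideanMeasure, himage,
    (isometry_toEuclidean_verticalParam i).euclideanHausdorffMeasure_image, ← hdim,
    InnerProductSpace.euclideanHausdorffMeasure_eq_volume]
  rw [show WithLp.toLp 2 '' T = (MeasurableEquiv.toLp 2 (F × ℝ)).symm ⁻¹' T from
    (MeasurableEquiv.toLp 2 (F × ℝ)).image_eq_preimage_symm T]
  exact (WithLp.volume_preserving_symm_measurableEquiv_toLp_prod F ℝ).measure_preimage_equiv T

theorem volume_preimage_verticalParam_cBall (hρ : IsHomogeneousDistance ρ)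
    (i : F →ₗᵢ[ℝ] Horizontal n) (p : Heis n) (r : ℝ) :
    volume (verticalParam i ⁻¹' cBall ρ p r) = volume (ballSlice ρ i p.z r) := by
  have hg : Continuous fun u => -p.t - 1 / 2 * symp p.z (i u) := by
    have := i.continuous
    fun_prop
  rw [← volume_preimage_shear hg.measurable (ballSlice ρ i p.z r)]
  congr 1
  ext x
  simp only [cBall, ballSlice, verticalParam, mem_preimage, mem_ofPred_eq, hρ.dist_eq_dist_one p,
    sub_eq_add_neg, add_assoc]

theorem volume_ballSlice_add_map (i : F →ₗᵢ[ℝ] Horizontal n) (w : Horizontal n) (b : F) (r : ℝ) :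
    volume (ballSlice ρ i (w + i b) r) = volume (ballSlice ρ i w r) := by
  have : (volume : Measure (F × ℝ)).IsAddRightInvariant :=
    Measure.prod.instIsAddRightInvariant
  rw [← measure_preimage_add_right volume (-b, 0) (ballSlice ρ i w r)]
  congr 1
  ext x
  have hsub : i (x.1 + -b) - w = i x.1 - (w + i b) := by
    rw [map_add, map_neg]
    abel
  simp only [ballSlice, mem_preimage, mem_ofPred_eq, Prod.fst_add, Prod.snd_add, add_zero, hsub]

theorem volume_preimage_dilation {r : ℝ} (hr : 0 < r) (S : Set (F × ℝ)) :
    volume ((fun x : F × ℝ => (r⁻¹ • x.1, r⁻¹ ^ 2 • x.2)) ⁻¹' S) =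
      ENNReal.ofReal r ^ (finrank ℝ F + 2) * volume S := by
  have hr' : r⁻¹ ≠ 0 := inv_ne_zero hr.ne'
  let e : F × ℝ ≃ᵐ F × ℝ := MeasurableEquiv.prodCongr (MeasurableEquiv.smul₀ r⁻¹ hr')
    (MeasurableEquiv.smul₀ (r⁻¹ ^ 2) (pow_ne_zero 2 hr'))
  have hmap : (volume : Measure (F × ℝ)).map e =
      ENNReal.ofReal r ^ (finrank ℝ F + 2) • volume := by
    change ((volume : Measure F).prod (volume : Measure ℝ)).map
      (Prod.map (r⁻¹ • ·) (r⁻¹ ^ 2 • ·)) = _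
    rw [← Measure.map_prod_map _ _ (measurable_const_smul _) (measurable_const_smul _),
      Measure.map_addHaar_smul _ hr', Measure.map_addHaar_smul _ (pow_ne_zero 2 hr'),
      Measure.prod_smul_left, Measure.prod_smul_right, smul_smul, finrank_self,
      ← ENNReal.ofReal_mul (abs_nonneg _), ← ENNReal.ofReal_pow hr.le]
    congr 2
    simp [abs_of_pos hr, pow_add]
  calc volume (e ⁻¹' S) = volume.map e S := (e.map_apply S).symm
    _ = ENNReal.ofReal r ^ (finrank ℝ F + 2) * volume S := by
      rw [hmap, Measure.smul_apply, smul_eq_mul]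

theorem volume_ballSlice_smul (hρ : IsHomogeneousDistance ρ) (i : F →ₗᵢ[ℝ] Horizontal n)
    (w : Horizontal n) {r : ℝ} (hr : 0 < r) :
    volume (ballSlice ρ i (r • w) r) =
      ENNReal.ofReal r ^ (finrank ℝ F + 2) * volume (ballSlice ρ i w 1) := by
  rw [← volume_preimage_dilation hr]
  congr 1
  ext x
  have hdil : (⟨i x.1 - r • w, x.2⟩ : Heis n) =
      dil r ⟨i (r⁻¹ • x.1) - w, r⁻¹ ^ 2 • x.2⟩ := by
    ext1
    · simp [dil, smul_sub, smul_smul, hr.ne']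
    · simp [dil, hr.ne']
  simp only [ballSlice, mem_preimage, mem_ofPred_eq]
  rw [hdil, hρ.dist_one_dil hr, mul_le_iff_le_one_right hr]

variable (ρ F) in
/-- The supremum of the volumes of the slices of unit balls by the vertical subgroups of dimension
`dim F + 1`. -/
noncomputable def maxSlice : ℝ≥0∞ :=
  ⨆ (i : F →ₗᵢ[ℝ] Horizontal n) (w : Horizontal n), volume (ballSlice ρ i w 1)

theorem iSup_volume_ballSlice_eq_maxSlice (hrot : IsRotationallyInvariant ρ)
    (i : F →ₗᵢ[ℝ] Horizontal n) : ⨆ w, volume (ballSlice ρ i w 1) = maxSlice ρ F := by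
  refine le_antisymm (le_iSup (fun i => ⨆ w, volume (ballSlice ρ i w 1)) i)
    (iSup₂_le fun j w => ?_)
  obtain ⟨U, rfl⟩ := exists_linearIsometry_comp_eq j i
  rw [← ballSlice_comp hrot U]
  exact le_iSup (fun w => volume (ballSlice ρ (U.comp j) w 1)) (U w)

theorem maxSlice_ne_top (hρ : IsHomogeneousDistance ρ) (hrot : IsRotationallyInvariant ρ) :
    maxSlice ρ F ≠ ∞ := by
  obtain ⟨s, T, hsT⟩ := exists_ballSlice_subset (F := F) hρ hrot
  have hle : maxSlice ρ F ≤ volume (closedBall (0 : F) s) * volume (closedBall (0 : ℝ) T) := by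
    refine iSup₂_le fun i w => ?_
    obtain ⟨c, hc⟩ := hsT i w
    rw [← Measure.addHaar_closedBall_center volume c s, ← Measure.prod_prod]
    exact measure_mono hc
  exact ne_top_of_le_ne_top
    (ENNReal.mul_ne_top measure_closedBall_lt_top.ne measure_closedBall_lt_top.ne) hle

theorem maxSlice_ne_zero (hρ : IsHomogeneousDistance ρ) (hrot : IsRotationallyInvariant ρ)
    (i : F →ₗᵢ[ℝ] Horizontal n) : maxSlice ρ F ≠ 0 := by
  obtain ⟨K₁, K₂, hK⟩ := hρ.exists_dist_one_le hrot
  let V : Set (F × ℝ) := {x | K₁ * ‖x.1‖ + K₂ * √|x.2| < 1}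
  have hV : IsOpen V := isOpen_lt (by fun_prop) continuous_const
  have hsub : V ⊆ ballSlice ρ i 0 1 := fun x hx => by
    have h := hK (i x.1 - 0) x.2
    rw [sub_zero, i.norm_map] at h
    rw [ballSlice, mem_ofPred_eq, sub_zero]
    exact h.trans hx.le
  have hpos : 0 < volume V := hV.measure_pos volume ⟨0, by simp [V]⟩
  exact (hpos.trans_le ((measure_mono hsub).trans (le_iSup₂_of_le i 0 le_rfl))).ne'

theorem volume_preimage_verticalParam_cBall_le (hρ : IsHomogeneousDistance ρ)
    (i : F →ₗᵢ[ℝ] Horizontal n) (p : Heis n) {r : ℝ} (hr : 0 < r) :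
    volume (verticalParam i ⁻¹' cBall ρ p r) ≤
      ENNReal.ofReal r ^ (finrank ℝ F + 2) * maxSlice ρ F := by
  rw [volume_preimage_verticalParam_cBall hρ, ← smul_inv_smul₀ hr.ne' p.z,
    volume_ballSlice_smul hρ i _ hr]
  gcongr
  exact le_iSup₂_of_le i (r⁻¹ • p.z) le_rfl

theorem volume_preimage_verticalParam_cBall_mul_dil (hρ : IsHomogeneousDistance ρ)
    (i : F →ₗᵢ[ℝ] Horizontal n) (x : F × ℝ) (w : Horizontal n) {r : ℝ} (hr : 0 < r) :
    volume (verticalParam i ⁻¹' cBall ρ (verticalParam i x * dil r ⟨w, 0⟩) r) =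
      ENNReal.ofReal r ^ (finrank ℝ F + 2) * volume (ballSlice ρ i w 1) := by
  have hz : (verticalParam i x * dil r ⟨w, 0⟩).z = r • w + i x.1 := add_comm _ _
  rw [volume_preimage_verticalParam_cBall hρ, hz, volume_ballSlice_add_map,
    volume_ballSlice_smul hρ i w hr]

theorem exists_center_le_volume_preimage_cBall (hρ : IsHomogeneousDistance ρ)
    (hrot : IsRotationallyInvariant ρ) (i : F →ₗᵢ[ℝ] Horizontal n) {η : ℝ≥0∞}
    (hη : η < maxSlice ρ F) :
    ∃ R : ℝ, ∀ x ∈ range (verticalParam i), ∀ r, 0 < r → ∃ p, ρ p x ≤ R * r ∧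
      ENNReal.ofReal r ^ (finrank ℝ F + 2) * η ≤ volume (verticalParam i ⁻¹' cBall ρ p r) := by
  rw [← iSup_volume_ballSlice_eq_maxSlice hrot i] at hη
  obtain ⟨w, hw⟩ := lt_iSup_iff.1 hη
  refine ⟨ρ 1 ⟨w, 0⟩, ?_⟩
  rintro _ ⟨x, rfl⟩ r hr
  refine ⟨verticalParam i x * dil r ⟨w, 0⟩, ?_, ?_⟩
  · rw [hρ.symm, hρ.dist_mul_right, hρ.dist_one_dil hr, mul_comm]
  · rw [volume_preimage_verticalParam_cBall_mul_dil hρ i x w hr]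
    gcongr

theorem maxSlice_mul_sphericalMeasure_image (hρ : IsHomogeneousDistance ρ)
    (hrot : IsRotationallyInvariant ρ) (i : F →ₗᵢ[ℝ] Horizontal n) (T : Set (F × ℝ)) :
    maxSlice ρ F / 2 ^ (finrank ℝ F + 2) *
      sphericalMeasure ρ ((finrank ℝ F + 2 : ℕ) : ℝ) (verticalParam i '' T) = volume T := by
  let _ := hρ.metricSpace
  let _ : MeasurableSpace (Heis n) := borel _
  have : BorelSpace (Heis n) := ⟨rfl⟩
  have : SecondCountableTopology (Heis n) :=
    (hρ.isHomeomorph_toEuclidean hrot).isEmbedding.secondCountableTopology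
  have hemb := (isClosedEmbedding_verticalParam hρ hrot i).measurableEmbedding
  let μ : Measure (Heis n) := volume.map (verticalParam i)
  have hμball : ∀ p r, μ (closedBall p r) = volume (verticalParam i ⁻¹' cBall ρ p r) :=
    fun p r => by rw [hemb.map_apply, hρ.closedBall_eq_cBall]
  have hupper : ∀ p r, 0 < r → μ (closedBall p r) ≤ maxSlice ρ F / 2 ^ (finrank ℝ F + 2) *
      ENNReal.ofReal (2 * r) ^ ((finrank ℝ F + 2 : ℕ) : ℝ) := fun p r hr => by
    rw [hμball, div_two_pow_mul_ofReal_rpow]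
    exact volume_preimage_verticalParam_cBall_le hρ i p hr
  have hlower : ∀ η < maxSlice ρ F / 2 ^ (finrank ℝ F + 2), ∃ R : ℝ,
      ∀ x ∈ verticalParam i '' T, ∀ r, 0 < r → ∃ p, dist p x ≤ R * r ∧
        η * ENNReal.ofReal (2 * r) ^ ((finrank ℝ F + 2 : ℕ) : ℝ) ≤ μ (closedBall p r) := by
    intro η hη
    obtain ⟨R, hR⟩ := exists_center_le_volume_preimage_cBall hρ hrot i
      ((ENNReal.lt_div_iff_mul_lt (by simp) (by simp)).1 hη)
    refine ⟨R, fun x hx r hr => ?_⟩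
    obtain ⟨p, hp, hvol⟩ := hR x (image_subset_range _ _ hx) r hr
    refine ⟨p, hp, ?_⟩
    rwa [hμball, ← ENNReal.mul_div_cancel_right (a := η) (b := 2 ^ (finrank ℝ F + 2)) (by simp)
      (by simp), div_two_pow_mul_ofReal_rpow]
  have hzero := maxSlice_ne_zero hρ hrot i
  have htop := maxSlice_ne_top (F := F) hρ hrot
  have : IsLocallyFiniteMeasure μ :=
    ⟨fun p => ⟨_, closedBall_mem_nhds p one_pos, (hupper p 1 one_pos).trans_lt (by finiteness)⟩⟩
  rw [← hρ.sphericalHausdorff_eq_sphericalMeasure, mul_sphericalHausdorff_eq_measure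
    (by positivity) (ENNReal.div_ne_zero.2 ⟨hzero, by simp⟩) (ENNReal.div_ne_top htop (by simp))
    hupper hlower, hemb.map_apply, preimage_image_eq T hemb.injective]

theorem maxSlice_mul_sphericalMeasure_eq_euclideanMeasure (hρ : IsHomogeneousDistance ρ)
    (hrot : IsRotationallyInvariant ρ) {W : Submodule ℝ (Horizontal n)} {P : Set (Heis n)}
    (hW : finrank ℝ W = finrank ℝ F) (hP : ∀ p, p ∈ P ↔ p.z ∈ W) (A : Set (Heis n)) :
    maxSlice ρ F / 2 ^ (finrank ℝ F + 2) *
      sphericalMeasure ρ ((finrank ℝ F + 2 : ℕ) : ℝ) (A ∩ P) =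
        euclideanMeasure (finrank ℝ F + 1) (A ∩ P) := by
  obtain ⟨i, rfl⟩ := exists_linearIsometry_range_eq hW
  have hrange : P = range (verticalParam i) := by
    ext p
    rw [hP]
    constructor
    · rintro ⟨u, hu⟩
      exact ⟨(u, p.t), Heis.ext hu rfl⟩
    · rintro ⟨x, rfl⟩
      exact ⟨x.1, rfl⟩
  rw [hrange, ← image_preimage_eq_inter_range, maxSlice_mul_sphericalMeasure_image hρ hrot,
    euclideanMeasure_image_verticalParam]

end Slices

end Heis

theorem mainTheorem7_general (n k : ℕ) (ρ : Heis n → Heis n → ℝ)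
    (hρ : Heis.IsHomogeneousDistance ρ) (hrot : Heis.IsRotationallyInvariant ρ) :
    ∃ c : ℝ≥0, 0 < c ∧ ∀ P : Subgroup (Heis n),
      (P ∈ Heis.tangentSubgroups n k ∨
        (Heis.IsVertical P ∧ Heis.topDim P = 2 * n + 1 - k)) →
      ∀ A : Set (Heis n),
        (c : ℝ≥0∞) * Heis.sphericalMeasure ρ (2 * (n : ℝ) + 2 - k) (A ∩ P) =
          Heis.euclideanMeasure (2 * n + 1 - k) (A ∩ P) := by
  let F := EuclideanSpace ℝ (Fin (2 * n - k))
  have hF : Module.finrank ℝ F = 2 * n - k := finrank_euclideanSpace_fin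
  have hle : Module.finrank ℝ F ≤ Module.finrank ℝ (Heis.Horizontal n) := by
    rw [hF, finrank_euclideanSpace, Fintype.card_sum, Fintype.card_fin]
    omega
  obtain ⟨i⟩ := nonempty_linearIsometry_of_finrank_le hle
  have hzero : Heis.maxSlice ρ F / 2 ^ (Module.finrank ℝ F + 2) ≠ 0 :=
    ENNReal.div_ne_zero.2 ⟨Heis.maxSlice_ne_zero hρ hrot i, by simp⟩
  have htop : Heis.maxSlice ρ F / 2 ^ (Module.finrank ℝ F + 2) ≠ ∞ :=
    ENNReal.div_ne_top (Heis.maxSlice_ne_top hρ hrot) (by simp)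
  refine ⟨_, ENNReal.toNNReal_pos hzero htop, fun P hP A => ?_⟩
  obtain ⟨W, hdim, hW⟩ := hP.elim Heis.exists_submodule_of_mem_tangentSubgroups
    fun h => h.1.exists_submodule_of_topDim_eq h.2
  have hd : 2 * (n : ℝ) + 2 - k = ((Module.finrank ℝ F + 2 : ℕ) : ℝ) := by
    rw [hF, eq_comm, eq_sub_iff_add_eq]
    norm_cast
    omega
  rw [ENNReal.coe_toNNReal htop, hd, Heis.maxSlice_mul_sphericalMeasure_eq_euclideanMeasure hρ hrot
    (by omega) hW]
  congr 1
  omega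

theorem mainTheorem7 (n k : ℕ) (hk : 1 ≤ k) (hkn : k ≤ n) (ρ : Heis n → Heis n → ℝ)
    (hρ : Heis.IsHomogeneousDistance ρ) (hrot : Heis.IsRotationallyInvariant ρ) :
    ∃ c : ℝ≥0, 0 < c ∧ ∀ P : Subgroup (Heis n),
      (P ∈ Heis.tangentSubgroups n k ∨
        (Heis.IsVertical P ∧ Heis.topDim P = 2 * n + 1 - k)) →
      ∀ A : Set (Heis n),
        (c : ℝ≥0∞) * Heis.sphericalMeasure ρ (2 * (n : ℝ) + 2 - k) (A ∩ P) =
          Heis.euclideanMeasure (2 * n + 1 - k) (A ∩ P) :=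
  mainTheorem7_general n k ρ hρ hrot
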